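/- Let $q$ be a prime power, $t\ge 1$, and let $\mathbf n=(n_1,\dots,n_t)$, $\mathbf m=(m_1,\dots,m_t)$ be tuples of positive integers with $m_1\ge\cdots\ge m_t$ and $n_i\le m_i$ for all $i$. Let $V=\mathbb F_q^{n_1\times m_1}\times\cdots\times\mathbb F_q^{n_t\times m_t}$ and $\mathrm{srk}(X)=\sum_{i=1}^t\mathrm{rk}(X_i)$ for $X\in V$. For $C\subseteq V$ let $\mathrm{srk}(C)=\min\{\mathrm{srk}(X-Y): X,Y\in C,\ X\ne Y\}$, with $\mathrm{srk}(C)=\infty$ if $|C|\le 1$. Let $d\ge 0$ be an integer. **Schrijver-type SDP.** Let $\mathrm{SDP}(q,\mathbf n,\mathbf m,d)$ be the maximum of $\mathrm{tr}(X)$ over all real symmetric, entrywise nonnegative, positive semidefinite matrices $X=(x_{u,v})_{u,v\in V}$ with $x_{\mathbf 0,\mathbf 0}=1$, with $x_{\mathbf 0,u}=x_{u,u}$ for all $u\in V$, and with $x_{u,v}=0$ whenever $\mathrm{srk}(\{\mathbf 0,u,v\})<d$. **Delsarte's LP bound.** For integers $1\le n\le m$ put $$b_v=\frac{q^{2v}(q^{m-v}-1)(q^{n-v}-1)}{q-1},\quad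 c_v=\frac{q^{v-1}(q^v-1)}{q-1},\quad a_v=b_0-b_v-c_v,\quad \theta_u=\frac{(q^{n-u}-1)(q^m-q^u)-q^u+1}{q-1},$$ $p_0(\theta)=1$, $p_1(\theta)=\theta$, $p_v(\theta)=\frac1{c_v}\big((\theta-a_{v-1})p_{v-1}(\theta)-b_{v-2}p_{v-2}(\theta)\big)$ for $2\le v\le n$. Let $Q^{(i)}=(p_v(\theta_u))_{0\le u,v\le n_i}$ for $(n,m)=(n_i,m_i)$, and $Q=Q^{(1)}\otimes\cdots\otimes Q^{(t)}$. Let $D(q,\mathbf n,\mathbf m,d)$ be the maximum of $\sum_{\mathbf j}a_{\mathbf j}$ over all real vectors $\mathbf a=(a_{\mathbf j})$, $\mathbf j=(j_1,\dots,j_t)\in\{0,\dots,n_1\}\times\cdots\times\{0,\dots,n_t\}$, with $\mathbf a\ge 0$, $\mathbf aQ\ge 0$, $a_{(0,\dots,0)}=1$, and $a_{\mathbf j}=0$ whenever $0<\sum_i j_i<d$. **Delsarte's bound in semidefinite form.** Let $D'(q,\mathbf n,\mathbf m,d)$ be the maximum of $\sum_{u,v\in V}b_{u,v}$ over all real symmetric,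 entrywise nonnegative, positive semidefinite matrices $B=(b_{u,v})_{u,v\in V}$ with $\mathrm{tr}(B)=1$ and with $b_{u,v}=0$ whenever $u\ne v$ and $\mathrm{srk}(u-v)<d$. Then all three maxima are attained, and $$\mathrm{SDP}(q,\mathbf n,\mathbf m,d)\le D(q,\mathbf n,\mathbf m,d)\qquad\text{and}\qquad \mathrm{SDP}(q,\mathbf n,\mathbf m,d)\le D'(q,\mathbf n,\mathbf m,d).$$ -/

import Mathlib

noncomputable section

namespace SumRank

/-! ### The sum-rank-metric space -/

/-- The sum-rank-metric space `F^{n × m} = F^{n₁ × m₁} × ⋯ × F^{n_t × m_t}`. -/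
abbrev Space (F : Type*) {t : ℕ} (n m : Fin t → ℕ) : Type _ :=
  (i : Fin t) → Matrix (Fin (n i)) (Fin (m i)) F

/-- The sum-rank `srk(X) = ∑ i, rk(X_i)`. -/
def srk {F : Type*} [Field F] {t : ℕ} {n m : Fin t → ℕ} (X : Space F n m) : ℕ :=
  ∑ i, (X i).rank

/-- The minimum sum-rank distance of a set of words: the minimum of `srk(X - Y)` over distinct
`X, Y ∈ C`, which is `∞` when `C` has at most one element. -/
def minDist {F : Type*} [Field F] {t : ℕ} {n m : Fin t → ℕ} (C : Set (Space F n m)) : ℕ∞ :=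
  ⨅ (X ∈ C) (Y ∈ C) (_ : X ≠ Y), (srk (X - Y) : ℕ∞)

/-! ### The three-point (Schrijver-type) semidefinite program -/

/-- Feasible solutions of the Schrijver-type SDP. -/
structure IsSchrijverFeasible {F : Type*} [Field F] {t : ℕ} {n m : Fin t → ℕ}
    (d : ℕ) (X : Matrix (Space F n m) (Space F n m) ℝ) : Prop where
  zero_zero : X 0 0 = 1
  zero_left : ∀ u, X 0 u = X u u
  dist : ∀ u v, minDist ({0, u, v} : Set (Space F n m)) < (d : ℕ∞) → X u v = 0
  symm : ∀ u v, X u v = X v u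
  nonneg : ∀ u v, 0 ≤ X u v
  posSemidef : X.PosSemidef

/-- The objective values `tr(X)` attained by feasible solutions of the Schrijver-type SDP. -/
def schrijverValues (F : Type*) [Field F] [Fintype F] {t : ℕ} (n m : Fin t → ℕ) (d : ℕ) :
    Set ℝ :=
  {r | ∃ X : Matrix (Space F n m) (Space F n m) ℝ, IsSchrijverFeasible d X ∧ r = X.trace}

/-- The optimum value of the Schrijver-type SDP. -/
def schrijverSDP (F : Type*) [Field F] [Fintype F] {t : ℕ} (n m : Fin t → ℕ) (d : ℕ) : ℝ :=
  sSup (schrijverValues F n m d)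

/-! ### Delsarte's linear program for the sum-rank-metric scheme -/

/-- `b_v = q^{2v} (q^{m-v} - 1) (q^{n-v} - 1) / (q - 1)`, used for `v ≤ n ≤ m`. -/
def bilinB (q n m v : ℕ) : ℝ :=
  (q : ℝ) ^ (2 * v) * ((q : ℝ) ^ (m - v) - 1) * ((q : ℝ) ^ (n - v) - 1) / ((q : ℝ) - 1)

/-- `c_v = q^{v-1} (q^v - 1) / (q - 1)`; in particular `c_0 = 0`. -/
def bilinC (q v : ℕ) : ℝ :=
  (q : ℝ) ^ (v - 1) * ((q : ℝ) ^ v - 1) / ((q : ℝ) - 1)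

/-- `a_v = b_0 - b_v - c_v`. -/
def bilinA (q n m v : ℕ) : ℝ :=
  bilinB q n m 0 - bilinB q n m v - bilinC q v

/-- The eigenvalues
`θ_u = ((q^{n-u} - 1) (q^m - q^u) - q^u + 1) / (q - 1)`, `0 ≤ u ≤ n`,
of the bilinear forms graph on `n × m` matrices. -/
def bilinTheta (q n m u : ℕ) : ℝ :=
  (((q : ℝ) ^ (n - u) - 1) * ((q : ℝ) ^ m - (q : ℝ) ^ u) - (q : ℝ) ^ u + 1) / ((q : ℝ) - 1)

/-- The polynomials `p_v` evaluated at `θ`: `p_0 = 1`, `p_1 = θ` and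
`p_v = ((θ - a_{v-1}) p_{v-1} - b_{v-2} p_{v-2}) / c_v` for `v ≥ 2`. -/
def bilinP (q n m : ℕ) (θ : ℝ) : ℕ → ℝ
  | 0 => 1
  | 1 => θ
  | v + 2 =>
      ((θ - bilinA q n m (v + 1)) * bilinP q n m θ (v + 1) - bilinB q n m v * bilinP q n m θ v)
        / bilinC q (v + 2)

/-- The second eigenmatrix of the bilinear forms scheme on `n × m` matrices. -/
def bilinQ (q n m : ℕ) : Matrix (Fin (n + 1)) (Fin (n + 1)) ℝ :=
  Matrix.of fun u v => bilinP q n m (bilinTheta q n m u) v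

/-- The index set `{0, …, n₁} × ⋯ × {0, …, n_t}` of the relations of the sum-rank-metric
scheme. -/
abbrev Idx {t : ℕ} (n : Fin t → ℕ) : Type :=
  (i : Fin t) → Fin (n i + 1)

/-- The second eigenmatrix of the sum-rank-metric scheme, the Kronecker product
`Q = Q⁽¹⁾ ⊗ ⋯ ⊗ Q⁽ᵗ⁾`. -/
def sumRankQ (q : ℕ) {t : ℕ} (n m : Fin t → ℕ) : Matrix (Idx n) (Idx n) ℝ :=
  Matrix.of fun j k => ∏ i, bilinQ q (n i) (m i) (j i) (k i)

/-- Feasible solutions of Delsarte's LP. -/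
structure IsDelsarteLPFeasible (q : ℕ) {t : ℕ} (n m : Fin t → ℕ) (d : ℕ) (a : Idx n → ℝ) :
    Prop where
  mul_Q_nonneg : ∀ k, 0 ≤ Matrix.vecMul a (sumRankQ q n m) k
  nonneg : ∀ j, 0 ≤ a j
  zero : a 0 = 1
  dist : ∀ j : Idx n, 0 < ∑ i, (j i : ℕ) → ∑ i, (j i : ℕ) < d → a j = 0

/-- The objective values attained by feasible solutions of Delsarte's LP. -/
def delsarteLPValues (q : ℕ) {t : ℕ} (n m : Fin t → ℕ) (d : ℕ) : Set ℝ :=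
  {r | ∃ a : Idx n → ℝ, IsDelsarteLPFeasible q n m d a ∧ r = ∑ j, a j}

/-- Delsarte's bound: the optimum value of Delsarte's LP. -/
def delsarteLP (q : ℕ) {t : ℕ} (n m : Fin t → ℕ) (d : ℕ) : ℝ :=
  sSup (delsarteLPValues q n m d)

/-! ### The semidefinite form of Delsarte's bound -/

/-- Feasible solutions of the semidefinite form of Delsarte's bound. -/
structure IsDelsarteSDPFeasible {F : Type*} [Field F] [Fintype F] {t : ℕ} {n m : Fin t → ℕ}
    (d : ℕ) (B : Matrix (Space F n m) (Space F n m) ℝ) : Prop where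
  nonneg : ∀ u v, 0 ≤ B u v
  symm : ∀ u v, B u v = B v u
  dist : ∀ u v, u ≠ v → srk (u - v) < d → B u v = 0
  trace : B.trace = 1
  posSemidef : B.PosSemidef

/-- The objective values attained by feasible solutions of the semidefinite form of Delsarte's
bound. -/
def delsarteSDPValues (F : Type*) [Field F] [Fintype F] {t : ℕ} (n m : Fin t → ℕ) (d : ℕ) :
    Set ℝ :=
  {r | ∃ B : Matrix (Space F n m) (Space F n m) ℝ,
    IsDelsarteSDPFeasible d B ∧ r = ∑ u, ∑ v, B u v}

/-- The optimum value of the semidefinite form of Delsarte's bound. -/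
def delsarteSDP (F : Type*) [Field F] [Fintype F] {t : ℕ} (n m : Fin t → ℕ) (d : ℕ) : ℝ :=
  sSup (delsarteSDPValues F n m d)

end SumRank

end

/-!
Every feasible point `X` of the three-point program is turned into a feasible point `B` of the
semidefinite form of Delsarte's program with at least the same value, and every such `B` into a
feasible point `a` of the linear program with the same value. So the three optima are ordered
`SDP ≤ D' ≤ D`, which contains both inequalities.

* `B = X / tr X`. The value `∑ X u v / tr X` is at least `tr X` by the Cauchy–Schwarz inequality
  `(∑ u, X 0 u) ^ 2 ≤ X 0 0 * ∑ u, ∑ v, X u v`, since the row of `X` at `0` is its diagonal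
  (`IsSchrijverFeasible.exists_isDelsarteSDPFeasible`).
* `a j` is the sum of the `B u v` for which `u - v` has the ranks `j`. The constraint `a Q ≥ 0`
  holds because `(a Q) k` is a sum of values of the form of `B` at additive characters of the
  space, namely those attached to the words with ranks `k`
  (`IsDelsarteSDPFeasible.exists_isDelsarteLPFeasible`).

The last point needs the entries of `Q`, which are given by a three-term recurrence, as character
sums: `p_v (θ_u) = ∑ ψ (tr (Mᵀ N))`, summed over the `M` of rank `v`, for any `N` of rank `u`
(`bilinP_bilinTheta`). The right-hand sides obey the same recurrence: multiplying by the sum for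
`v = 1` convolves with the set of rank-one matrices `x yᵀ`, so the coefficients count the rank-one
matrices whose subtraction from a matrix of rank `r` raises, keeps or lowers the rank. Rank rises
iff `x` is outside the column space and `y` outside the row space; it falls iff `y` is in the row
space and `x = M z` with `y ⬝ z = 1`; counting these pairs gives `(q - 1) b_r` and `(q - 1) c_r`
(`card_pairs_rank_sub_eq`).

The maxima are attained because the feasible sets are nonempty and compact. For the linear
program, boundedness comes from summing all the constraints `(a Q) k ≥ 0`: every row of `Q` but
the one at `0` sums to zero (`IsDelsarteLPFeasible.sum_le`).
-/

noncomputable section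

namespace SumRank

/-! ### The rank of a rank-one perturbation -/

section RankOne

variable {K V W : Type*} [Field K] [AddCommGroup V] [Module K V]
  [AddCommGroup W] [Module K W]

open Module

lemma finrank_range_sub_smulRight_of_notMem_of_notMem [FiniteDimensional K W]
    (f : V →ₗ[K] W) (φ : Dual K V) (x : W)
    (hx : x ∉ LinearMap.range f) (hφ : φ ∉ (LinearMap.ker f).dualAnnihilator) :
    finrank K (LinearMap.range (f - φ.smulRight x)) = finrank K (LinearMap.range f) + 1 := by
  rw [← Submodule.finrank_sup_span_singleton hx]
  suffices h : LinearMap.range (f - φ.smulRight x) = LinearMap.range f ⊔ K ∙ x by rw [h]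
  obtain ⟨k, hk, hφk⟩ : ∃ k, f k = 0 ∧ φ k ≠ 0 := by
    simpa [Submodule.mem_dualAnnihilator] using hφ
  -- a kernel vector of `f` not killed by `φ` puts `x`, hence the range of `f`, into the new range
  have hmem : x ∈ LinearMap.range (f - φ.smulRight x) :=
    ⟨-(φ k)⁻¹ • k, by simp [hk, hφk]⟩
  apply le_antisymm
  · rintro _ ⟨z, rfl⟩
    exact Submodule.sub_mem_sup ⟨z, rfl⟩
      (Submodule.smul_mem _ _ (Submodule.mem_span_singleton_self x))
  · rw [sup_le_iff, Submodule.span_singleton_le_iff_mem]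
    refine ⟨?_, hmem⟩
    rintro _ ⟨z, rfl⟩
    have := add_mem (LinearMap.mem_range_self (f - φ.smulRight x) z)
      (Submodule.smul_mem _ (φ z) hmem)
    simpa using this

lemma finrank_range_sub_smulRight_of_notMem_of_mem [FiniteDimensional K V]
    (f : V →ₗ[K] W) (φ : Dual K V) (x : W)
    (hx : x ∉ LinearMap.range f) (hφ : φ ∈ (LinearMap.ker f).dualAnnihilator) :
    finrank K (LinearMap.range (f - φ.smulRight x)) = finrank K (LinearMap.range f) := by
  rw [Submodule.mem_dualAnnihilator] at hφ
  have hker : LinearMap.ker (f - φ.smulRight x) = LinearMap.ker f := by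
    ext z
    simp only [LinearMap.mem_ker, LinearMap.sub_apply, LinearMap.smulRight_apply]
    refine ⟨fun h => ?_, fun h => by simp [h, hφ z h]⟩
    by_cases hz : φ z = 0
    · simpa [hz] using h
    · refine absurd ⟨(φ z)⁻¹ • z, ?_⟩ hx
      rw [map_smul, sub_eq_zero.1 h, inv_smul_smul₀ hz]
  have h1 := LinearMap.finrank_range_add_finrank_ker f
  have h2 := LinearMap.finrank_range_add_finrank_ker (f - φ.smulRight x)
  rw [hker] at h2
  omega

lemma finrank_range_sub_smulRight_of_apply_ne_one [FiniteDimensional K V]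
    (f : V →ₗ[K] W) (φ : Dual K V) (z : V)
    (hz : φ z ≠ 1) :
    finrank K (LinearMap.range (f - φ.smulRight (f z))) = finrank K (LinearMap.range f) := by
  -- the new map is `f` composed with an automorphism of `V`
  set h : V →ₗ[K] V := LinearMap.id - φ.smulRight z
  have hinj : Function.Injective h := by
    rw [← LinearMap.ker_eq_bot, LinearMap.ker_eq_bot']
    intro w hw
    have hw' : w = φ w • z := by simpa [h, sub_eq_zero] using hw
    have h1 : φ w = φ w * φ z := by
      conv_lhs => rw [hw']
      simp
    have h2 : φ w = 0 := by
      by_contra h0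
      exact hz (mul_left_cancel₀ h0 (by rw [← h1, mul_one]))
    rw [hw', h2, zero_smul]
  have hcomp : f - φ.smulRight (f z) = f ∘ₗ h := by
    ext w
    simp [h]
  rw [hcomp, LinearMap.range_comp_of_range_eq_top _
    (LinearMap.range_eq_top.2 (LinearMap.surjective_of_injective hinj))]

lemma finrank_range_sub_smulRight_of_apply_eq_one [FiniteDimensional K W]
    (f : V →ₗ[K] W) (φ : Dual K V) (z : V)
    (hφ : φ ∈ (LinearMap.ker f).dualAnnihilator) (hz : φ z = 1) :
    finrank K (LinearMap.range (f - φ.smulRight (f z))) + 1 = finrank K (LinearMap.range f) := by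
  rw [Submodule.mem_dualAnnihilator] at hφ
  -- `f` arises from the new map by a rank-one perturbation that raises the rank
  have key := finrank_range_sub_smulRight_of_notMem_of_notMem (f - φ.smulRight (f z)) φ (-(f z))
    (by
      rintro ⟨w, hw⟩
      have h1 : w - φ w • z + z ∈ LinearMap.ker f := by
        simp only [LinearMap.sub_apply, LinearMap.smulRight_apply] at hw
        simp [hw]
      have h2 := hφ _ h1
      simp [hz] at h2)
    (by
      intro h
      rw [Submodule.mem_dualAnnihilator] at h
      have := h z (by simp [hz])
      simp [hz] at this)
  rw [← key]
  have hf : f - φ.smulRight (f z) - φ.smulRight (-f z) = f := by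
    ext w
    simp
  rw [hf]

end RankOne

/-! ### Counting rank-one perturbations of a matrix -/

section Count

open Matrix Module

variable {F : Type*} [Field F] {ι κ : Type*} [Fintype ι] [Fintype κ]

/-- The row space of `M`, described as the orthogonal complement of its kernel. -/
def rowSpace (M : Matrix ι κ F) : Submodule F (κ → F) where
  carrier := {y | ∀ z, M *ᵥ z = 0 → y ⬝ᵥ z = 0}
  add_mem' {a b} ha hb z hz := by rw [add_dotProduct, ha z hz, hb z hz, add_zero]
  zero_mem' z _ := zero_dotProduct z
  smul_mem' c a ha z hz := by rw [smul_dotProduct, ha z hz, smul_zero]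

omit [Fintype ι] in
lemma mem_rowSpace {M : Matrix ι κ F} {y : κ → F} :
    y ∈ rowSpace M ↔ ∀ z, M *ᵥ z = 0 → y ⬝ᵥ z = 0 := Iff.rfl

variable [DecidableEq κ]

omit [Fintype ι] in
lemma dotProductEquiv_mem_dualAnnihilator {M : Matrix ι κ F} {y : κ → F} :
    dotProductEquiv F κ y ∈ (LinearMap.ker M.mulVecLin).dualAnnihilator ↔ y ∈ rowSpace M := by
  simp [Submodule.mem_dualAnnihilator, mem_rowSpace]

omit [Fintype ι] in
lemma map_rowSpace (M : Matrix ι κ F) :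
    (rowSpace M).map (dotProductEquiv F κ).toLinearMap =
      (LinearMap.ker M.mulVecLin).dualAnnihilator := by
  ext φ
  obtain ⟨y, rfl⟩ := (dotProductEquiv F κ).surjective φ
  rw [dotProductEquiv_mem_dualAnnihilator]
  simp

omit [Fintype ι] in
lemma finrank_rowSpace (M : Matrix ι κ F) : finrank F (rowSpace M) = M.rank := by
  rw [← LinearEquiv.finrank_map_eq (dotProductEquiv F κ), map_rowSpace]
  have h1 := Subspace.finrank_add_finrank_dualAnnihilator_eq (LinearMap.ker M.mulVecLin)
  have h2 := LinearMap.finrank_range_add_finrank_ker M.mulVecLin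
  rw [Matrix.rank]
  omega

omit [Fintype ι] in
lemma exists_mem_rowSpace_dotProduct_ne_zero {M : Matrix ι κ F} {z : κ → F} (hz : M *ᵥ z ≠ 0) :
    ∃ y ∈ rowSpace M, y ⬝ᵥ z ≠ 0 := by
  by_contra! h
  refine hz ?_
  have : z ∈ LinearMap.ker M.mulVecLin := by
    rw [← Subspace.forall_mem_dualAnnihilator_apply_eq_zero_iff]
    intro φ hφ
    obtain ⟨y, rfl⟩ := (dotProductEquiv F κ).surjective φ
    simpa using h y (dotProductEquiv_mem_dualAnnihilator.1 hφ)
  simpa using this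

omit [Fintype ι] in
lemma rank_sub_vecMulVec_eq (M : Matrix ι κ F) (x : ι → F) (y : κ → F) :
    (M - vecMulVec x y).rank =
      finrank F (LinearMap.range (M.mulVecLin - (dotProductEquiv F κ y).smulRight x)) := by
  have h : (M - vecMulVec x y).mulVecLin =
      M.mulVecLin - (dotProductEquiv F κ y).smulRight x := by
    refine LinearMap.ext fun z => ?_
    simp [vecMulVec_mulVec]
  rw [Matrix.rank, h]

/-- `y` is in the row space of `M`, and `x = M z` with `y ⬝ᵥ z = 1`: this holds exactly when
subtracting `x yᵀ` from `M` lowers the rank. -/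
def Lowers (M : Matrix ι κ F) (x : ι → F) (y : κ → F) : Prop :=
  y ∈ rowSpace M ∧ ∃ z, M *ᵥ z = x ∧ y ⬝ᵥ z = 1

/-- `x` is outside the column space of `M` and `y` outside its row space: this holds exactly when
subtracting `x yᵀ` from `M` raises the rank. -/
def Raises (M : Matrix ι κ F) (x : ι → F) (y : κ → F) : Prop :=
  x ∉ LinearMap.range M.mulVecLin ∧ y ∉ rowSpace M

lemma Raises.rank {M : Matrix ι κ F} {x : ι → F} {y : κ → F} (h : Raises M x y) :
    (M - vecMulVec x y).rank = M.rank + 1 := by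
  rw [rank_sub_vecMulVec_eq]
  exact finrank_range_sub_smulRight_of_notMem_of_notMem _ _ _ h.1
    fun h' => h.2 (dotProductEquiv_mem_dualAnnihilator.1 h')

lemma Lowers.rank {M : Matrix ι κ F} {x : ι → F} {y : κ → F} (h : Lowers M x y) :
    (M - vecMulVec x y).rank + 1 = M.rank := by
  obtain ⟨hy, z, rfl, hz⟩ := h
  rw [rank_sub_vecMulVec_eq]
  exact finrank_range_sub_smulRight_of_apply_eq_one M.mulVecLin _ z
    (dotProductEquiv_mem_dualAnnihilator.2 hy) (by simpa using hz)

omit [Fintype ι] in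
lemma rank_sub_vecMulVec_of_not {M : Matrix ι κ F} {x : ι → F} {y : κ → F}
    (h₁ : ¬ Raises M x y) (h₂ : ¬ Lowers M x y) : (M - vecMulVec x y).rank = M.rank := by
  rw [rank_sub_vecMulVec_eq]
  by_cases hx : x ∈ LinearMap.range M.mulVecLin
  · obtain ⟨z, rfl⟩ := hx
    obtain ⟨w, hw, hw1⟩ : ∃ w, M *ᵥ w = M *ᵥ z ∧ y ⬝ᵥ w ≠ 1 := by
      by_cases hz : y ⬝ᵥ z = 1
      · -- shift `z` by a kernel vector on which `y` does not vanish
        have hy : y ∉ rowSpace M := fun hy => h₂ ⟨hy, z, rfl, hz⟩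
        obtain ⟨k, hk, hyk⟩ : ∃ k, M *ᵥ k = 0 ∧ y ⬝ᵥ k ≠ 0 := by
          simpa [mem_rowSpace] using hy
        exact ⟨z + k, by rw [mulVec_add, hk, add_zero], by simpa [dotProduct_add, hz] using hyk⟩
      · exact ⟨z, rfl, hz⟩
    have := finrank_range_sub_smulRight_of_apply_ne_one M.mulVecLin (dotProductEquiv F κ y) w
      (by simpa using hw1)
    rw [Matrix.rank, ← this, mulVecLin_apply, mulVecLin_apply, hw]
  · refine finrank_range_sub_smulRight_of_notMem_of_mem _ _ _ hx ?_
    by_contra hy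
    exact h₁ ⟨hx, fun h => hy (dotProductEquiv_mem_dualAnnihilator.2 h)⟩

variable [Fintype F] [DecidableEq ι]

open Classical in
lemma card_filter_raises (M : Matrix ι κ F) :
    (Finset.univ.filter fun p : (ι → F) × (κ → F) => Raises M p.1 p.2).card =
      (Fintype.card F ^ Fintype.card ι - Fintype.card F ^ M.rank) *
        (Fintype.card F ^ Fintype.card κ - Fintype.card F ^ M.rank) := by
  have h : (Finset.univ.filter fun p : (ι → F) × (κ → F) => Raises M p.1 p.2) =
      (Finset.univ.filter fun x => x ∈ LinearMap.range M.mulVecLin)ᶜ ×ˢ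
        (Finset.univ.filter fun y => y ∈ rowSpace M)ᶜ := by
    ext p
    rw [Finset.mem_product, Finset.mem_compl, Finset.mem_compl, Finset.mem_filter_univ,
      Finset.mem_filter_univ, Finset.mem_filter_univ]
    rfl
  rw [h, Finset.card_product, Finset.card_compl, Finset.card_compl, ← Fintype.card_subtype,
    ← Fintype.card_subtype, Fintype.card_fun, Fintype.card_fun]
  have h1 := Module.card_eq_pow_finrank (K := F) (V := LinearMap.range M.mulVecLin)
  have h2 := Module.card_eq_pow_finrank (K := F) (V := rowSpace M)
  rw [finrank_rowSpace] at h2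
  change _ = _ ^ M.rank at h1
  rw [h1, h2]

omit [Fintype ι] [DecidableEq ι] in
open Classical in
/-- A linear functional `y ↦ y ⬝ᵥ z` that is nonzero on the row space takes the value `1`
on a fraction `1 / q` of it. -/
lemma card_mul_card_filter_rowSpace (M : Matrix ι κ F) {z : κ → F} (hz : M *ᵥ z ≠ 0) :
    Fintype.card F * (Finset.univ.filter fun y => y ∈ rowSpace M ∧ y ⬝ᵥ z = 1).card =
      Fintype.card F ^ M.rank := by
  let ev : rowSpace M →ₗ[F] F :=
    { toFun := fun y => (y : κ → F) ⬝ᵥ z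
      map_add' := fun a b => by simp [add_dotProduct]
      map_smul' := fun c a => by simp [smul_dotProduct] }
  have hsurj : Function.Surjective ev := by
    obtain ⟨y, hy, hyz⟩ := exists_mem_rowSpace_dotProduct_ne_zero hz
    refine LinearMap.surjective fun h0 => hyz ?_
    exact congrArg (fun g => g ⟨y, hy⟩) h0
  have hfib : ∀ c : F, (Finset.univ.filter fun y : rowSpace M => ev y = c).card =
      (Finset.univ.filter fun y : rowSpace M => ev y = 1).card := fun c =>
    AddMonoidHom.card_fiber_eq_of_mem_range ev (hsurj c) (hsurj 1)
  have hcard : (Finset.univ : Finset (rowSpace M)).card = ∑ c : F,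
      (Finset.univ.filter fun y : rowSpace M => ev y = c).card :=
    Finset.card_eq_sum_card_fiberwise (fun _ _ => Finset.mem_univ _)
  rw [Finset.sum_congr rfl fun c _ => hfib c, Finset.sum_const, Finset.card_univ, smul_eq_mul,
    Finset.card_univ, Module.card_eq_pow_finrank (K := F), finrank_rowSpace] at hcard
  rw [hcard]
  congr 1
  symm
  refine Finset.card_bij (fun y _ => (y : κ → F)) ?_ ?_ ?_
  · intro a ha
    simpa [ev] using ha
  · intro a _ b _ hab
    exact Subtype.ext hab
  · intro b hb
    simp only [Finset.mem_filter, Finset.mem_univ, true_and] at hb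
    exact ⟨⟨b, hb.1⟩, by simpa [ev] using hb.2, rfl⟩

open Classical in
lemma card_mul_card_filter_lowers (M : Matrix ι κ F) :
    Fintype.card F * (Finset.univ.filter fun p : (ι → F) × (κ → F) => Lowers M p.1 p.2).card =
      (Fintype.card F ^ M.rank - 1) * Fintype.card F ^ M.rank := by
  have hfib : (Finset.univ.filter fun p : (ι → F) × (κ → F) => Lowers M p.1 p.2).card =
      ∑ x : ι → F, (Finset.univ.filter fun y => Lowers M x y).card := by
    simp only [Finset.card_filter]
    rw [Fintype.sum_prod_type]
  have hval : ∀ x : ι → F, Fintype.card F * (Finset.univ.filter fun y => Lowers M x y).card =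
      if x ∈ LinearMap.range M.mulVecLin ∧ x ≠ 0 then Fintype.card F ^ M.rank else 0 := by
    intro x
    split_ifs with hx
    · obtain ⟨⟨z, rfl⟩, hz⟩ := hx
      rw [← card_mul_card_filter_rowSpace M (z := z) (by simpa using hz)]
      congr 2
      ext y
      simp only [Finset.mem_filter, Finset.mem_univ, true_and]
      refine ⟨fun ⟨hy, w, hw, hyw⟩ => ⟨hy, ?_⟩, fun h => ⟨h.1, z, rfl, h.2⟩⟩
      have := hy (z - w) (by rw [mulVec_sub, hw, mulVecLin_apply, sub_self])
      rw [dotProduct_sub, sub_eq_zero] at this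
      rw [this, hyw]
    · rw [Finset.filter_eq_empty_iff.2, Finset.card_empty, mul_zero]
      rintro y - ⟨hy, z, rfl, hz⟩
      refine hx ⟨⟨z, rfl⟩, fun h0 => ?_⟩
      rw [hy z h0] at hz
      exact zero_ne_one hz
  rw [hfib, Finset.mul_sum, Finset.sum_congr rfl fun x _ => hval x, ← Finset.sum_filter,
    Finset.sum_const, smul_eq_mul]
  congr 1
  have h1 : Fintype.card (LinearMap.range M.mulVecLin) = Fintype.card F ^ M.rank :=
    Module.card_eq_pow_finrank (K := F) (V := LinearMap.range M.mulVecLin)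
  have h2 : (Finset.univ.filter fun x => x ∈ LinearMap.range M.mulVecLin ∧ x ≠ 0) =
      (Finset.univ.filter fun x => x ∈ LinearMap.range M.mulVecLin).erase 0 := by
    ext x
    simp only [Finset.mem_filter, Finset.mem_univ, true_and, Finset.mem_erase]
    exact and_comm
  rw [h2, Finset.card_erase_of_mem ((Finset.mem_filter_univ _).2 (zero_mem _)),
    ← Fintype.card_subtype, ← h1]

open Classical in
/-- The pairs of nonzero vectors, which parametrise the rank-one matrices `x yᵀ`. -/
def pairs (F ι κ : Type*) [Field F] [Fintype F] [Fintype ι] [Fintype κ]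
    [DecidableEq ι] [DecidableEq κ] : Finset ((ι → F) × (κ → F)) :=
  Finset.univ.filter fun p => p.1 ≠ 0 ∧ p.2 ≠ 0

lemma mem_pairs {p : (ι → F) × (κ → F)} : p ∈ pairs F ι κ ↔ p.1 ≠ 0 ∧ p.2 ≠ 0 := by
  simp [pairs]

lemma card_pairs : (pairs F ι κ).card =
    (Fintype.card F ^ Fintype.card ι - 1) * (Fintype.card F ^ Fintype.card κ - 1) := by
  classical
  have h : pairs F ι κ = (Finset.univ.erase 0) ×ˢ (Finset.univ.erase 0) := by
    ext p
    simp [pairs]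
  rw [h, Finset.card_product, Finset.card_erase_of_mem (Finset.mem_univ _),
    Finset.card_erase_of_mem (Finset.mem_univ _), Finset.card_univ, Finset.card_univ,
    Fintype.card_fun, Fintype.card_fun]

lemma Raises.mem_pairs {M : Matrix ι κ F} {p : (ι → F) × (κ → F)} (h : Raises M p.1 p.2) :
    p ∈ pairs F ι κ := by
  rw [SumRank.mem_pairs]
  exact ⟨fun h0 => h.1 (h0 ▸ zero_mem _), fun h0 => h.2 (h0 ▸ zero_mem _)⟩

lemma Lowers.mem_pairs {M : Matrix ι κ F} {p : (ι → F) × (κ → F)} (h : Lowers M p.1 p.2) :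
    p ∈ pairs F ι κ := by
  obtain ⟨hy, z, hz, hyz⟩ := h
  rw [SumRank.mem_pairs]
  refine ⟨fun h0 => ?_, fun h0 => ?_⟩
  · rw [hy z (hz.trans h0)] at hyz
    exact zero_ne_one hyz
  · rw [h0, zero_dotProduct] at hyz
    exact zero_ne_one hyz

end Count

/-! ### Intersection numbers of the bilinear forms scheme -/

section Intersection

open Matrix

variable {F : Type*} [Field F] [Fintype F]

lemma one_lt_card_real : (1 : ℝ) < Fintype.card F := by
  exact_mod_cast Fintype.one_lt_card

/-- The number of rank-one matrices `E`, for a fixed `M` of rank `r`, such that `M - E` has rank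
`v`; it is an intersection number of the bilinear forms scheme. -/
def rankStep (q n m r v : ℕ) : ℝ :=
  if r = v + 1 then bilinC q r else if r = v then bilinA q n m r
    else if r + 1 = v then bilinB q n m r else 0

lemma sub_one_mul_bilinB {q n m r : ℕ} (hq : (1 : ℝ) < q) (hn : r ≤ n) (hm : r ≤ m) :
    ((q : ℝ) - 1) * bilinB q n m r = ((q : ℝ) ^ n - q ^ r) * ((q : ℝ) ^ m - q ^ r) := by
  obtain ⟨a, rfl⟩ := Nat.exists_eq_add_of_le hn
  obtain ⟨b, rfl⟩ := Nat.exists_eq_add_of_le hm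
  have : (q : ℝ) - 1 ≠ 0 := by linarith
  rw [bilinB, mul_div_cancel₀ _ this]
  simp only [Nat.add_sub_cancel_left]
  ring

lemma sub_one_mul_bilinC {q r : ℕ} (hq : (1 : ℝ) < q) :
    ((q : ℝ) - 1) * bilinC q r = (q : ℝ) ^ (r - 1) * ((q : ℝ) ^ r - 1) := by
  have : (q : ℝ) - 1 ≠ 0 := by linarith
  rw [bilinC, mul_div_cancel₀ _ this]

lemma bilinC_zero (q : ℕ) : bilinC q 0 = 0 := by simp [bilinC]

lemma bilinC_one {q : ℕ} (hq : (1 : ℝ) < q) : bilinC q 1 = 1 := by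
  have : (q : ℝ) - 1 ≠ 0 := by linarith
  simp [bilinC, this]

lemma bilinC_pos {q r : ℕ} (hq : (1 : ℝ) < q) (hr : r ≠ 0) : 0 < bilinC q r := by
  have h1 := one_lt_pow₀ hq hr
  exact div_pos (mul_pos (by positivity) (by linarith)) (by linarith)

variable {n m : ℕ}

open Classical in
lemma card_raises (M : Matrix (Fin n) (Fin m) F) :
    (((pairs F (Fin n) (Fin m)).filter fun p => Raises M p.1 p.2).card : ℝ) =
      ((Fintype.card F : ℝ) - 1) * bilinB (Fintype.card F) n m M.rank := by
  have hn : M.rank ≤ n := M.rank_le_height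
  have hm : M.rank ≤ m := M.rank_le_width
  have hpos : 0 < Fintype.card F := Fintype.card_pos
  rw [sub_one_mul_bilinB one_lt_card_real hn hm]
  have h : (pairs F (Fin n) (Fin m)).filter (fun p => Raises M p.1 p.2) =
      Finset.univ.filter fun p => Raises M p.1 p.2 := by
    ext p
    simpa using Raises.mem_pairs
  rw [h, card_filter_raises, Fintype.card_fin, Fintype.card_fin, Nat.cast_mul,
    Nat.cast_sub (Nat.pow_le_pow_right hpos hn), Nat.cast_sub (Nat.pow_le_pow_right hpos hm)]
  push_cast
  rfl

open Classical in
lemma card_lowers (M : Matrix (Fin n) (Fin m) F) :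
    (((pairs F (Fin n) (Fin m)).filter fun p => Lowers M p.1 p.2).card : ℝ) =
      ((Fintype.card F : ℝ) - 1) * bilinC (Fintype.card F) M.rank := by
  have hpos : 0 < Fintype.card F := Fintype.card_pos
  have hq : (1 : ℝ) < Fintype.card F := one_lt_card_real
  have h : (pairs F (Fin n) (Fin m)).filter (fun p => Lowers M p.1 p.2) =
      Finset.univ.filter fun p => Lowers M p.1 p.2 := by
    ext p
    simpa using Lowers.mem_pairs
  rw [h, sub_one_mul_bilinC hq]
  have key := congrArg (Nat.cast : ℕ → ℝ) (card_mul_card_filter_lowers M)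
  rw [Nat.cast_mul, Nat.cast_mul, Nat.cast_sub (Nat.one_le_pow _ _ hpos)] at key
  push_cast at key
  have h0 : (Fintype.card F : ℝ) ≠ 0 := by linarith
  apply mul_left_cancel₀ h0
  rw [key]
  rcases M.rank with _ | r
  · simp
  · rw [Nat.add_sub_cancel]
    ring

open Classical in
/-- The factor `q - 1` arises because every rank-one matrix is `x yᵀ` for `q - 1` pairs. -/
lemma card_pairs_rank_sub_eq (M : Matrix (Fin n) (Fin m) F) (v : ℕ) :
    (((pairs F (Fin n) (Fin m)).filter fun p => (M - vecMulVec p.1 p.2).rank = v).card : ℝ) =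
      ((Fintype.card F : ℝ) - 1) * rankStep (Fintype.card F) n m M.rank v := by
  have hrank : ∀ p : (Fin n → F) × (Fin m → F), (M - vecMulVec p.1 p.2).rank = v ↔
      (Raises M p.1 p.2 ∧ M.rank + 1 = v) ∨ (Lowers M p.1 p.2 ∧ M.rank = v + 1) ∨
        ((¬ Raises M p.1 p.2 ∧ ¬ Lowers M p.1 p.2) ∧ M.rank = v) := by
    intro p
    by_cases h1 : Raises M p.1 p.2
    · have hl : ¬ Lowers M p.1 p.2 := fun h => h1.2 h.1
      simp [h1, hl, h1.rank]
    · by_cases h2 : Lowers M p.1 p.2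
      · have := h2.rank
        simp only [h1, h2, false_and, true_and, not_true_eq_false, and_false, or_false, false_or]
        omega
      · simp [h1, h2, rank_sub_vecMulVec_of_not h1 h2]
  simp only [hrank, rankStep]
  split_ifs with ha hb hc
  · simp only [ha, and_true, show ¬ (v + 1 + 1 = v) by omega, show ¬ (v + 1 = v) by omega,
      and_false, or_false, false_or]
    rw [card_lowers, ha]
  · simp only [hb, and_true, show ¬ (v = v + 1) by omega, show ¬ (v + 1 = v) by omega,
      and_false, false_or]
    have h1 := card_raises M
    have h2 := card_lowers M
    have h3 := Finset.card_filter_add_card_filter_not (s := pairs F (Fin n) (Fin m))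
      (fun p => Raises M p.1 p.2 ∨ Lowers M p.1 p.2)
    have h4 : ((pairs F (Fin n) (Fin m)).filter
        fun p => Raises M p.1 p.2 ∨ Lowers M p.1 p.2).card =
        ((pairs F (Fin n) (Fin m)).filter fun p => Raises M p.1 p.2).card +
        ((pairs F (Fin n) (Fin m)).filter fun p => Lowers M p.1 p.2).card := by
      rw [Finset.filter_or, Finset.card_union_of_disjoint]
      exact Finset.disjoint_filter.2 fun p _ h h' => h.2 h'.1
    have hpos : 0 < Fintype.card F := Fintype.card_pos
    have h5 : ((pairs F (Fin n) (Fin m)).card : ℝ) =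
        ((Fintype.card F : ℝ) - 1) * bilinB (Fintype.card F) n m 0 := by
      rw [sub_one_mul_bilinB one_lt_card_real (Nat.zero_le _) (Nat.zero_le _), card_pairs,
        Fintype.card_fin, Fintype.card_fin, Nat.cast_mul, Nat.cast_sub (Nat.one_le_pow _ _ hpos),
        Nat.cast_sub (Nat.one_le_pow _ _ hpos)]
      simp
    have h6 := congrArg (Nat.cast : ℕ → ℝ) h3
    rw [h4] at h6
    push_cast at h6
    rw [h1, h2, h5] at h6
    simp only [← not_or]
    rw [bilinA, ← hb]
    linarith
  · simp only [ha, hb, hc, and_true, and_false, or_false]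
    rw [card_raises]
  · simp [ha, hb, hc]

/-- By induction: a matrix of rank `r < min n m` has a perturbation of rank `r + 1`, because
`b_r` is positive. -/
lemma exists_rank_eq {r : ℕ} (hn : r ≤ n) (hm : r ≤ m) :
    ∃ M : Matrix (Fin n) (Fin m) F, M.rank = r := by
  classical
  induction r with
  | zero => exact ⟨0, rank_zero⟩
  | succ r ih =>
    obtain ⟨M, hM⟩ := ih (by omega) (by omega)
    have hcard : 0 < (Finset.univ.filter
        fun p : (Fin n → F) × (Fin m → F) => Raises M p.1 p.2).card := by
      rw [card_filter_raises, Fintype.card_fin, Fintype.card_fin, hM]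
      exact Nat.mul_pos (Nat.sub_pos_of_lt (Nat.pow_lt_pow_right Fintype.one_lt_card hn))
        (Nat.sub_pos_of_lt (Nat.pow_lt_pow_right Fintype.one_lt_card hm))
    obtain ⟨p, hp⟩ := Finset.card_pos.1 hcard
    rw [Finset.mem_filter_univ] at hp
    exact ⟨_, hp.rank.trans (by rw [hM])⟩

end Intersection

/-! ### Eigenvalues of the bilinear forms scheme as character sums -/

section Characters

open Matrix

variable {F : Type*} [Field F] {n m : ℕ}

lemma matrix_rank_eq_zero {M : Matrix (Fin n) (Fin m) F} : M.rank = 0 ↔ M = 0 := by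
  rw [Matrix.rank, Submodule.finrank_eq_zero, LinearMap.range_eq_bot, ← Matrix.toLin'_apply',
    LinearEquiv.map_eq_zero_iff]

/-- The bilinear form `⟨M, N⟩ = ∑ M i j * N i j = tr (Mᵀ N)`. -/
def pairing (M N : Matrix (Fin n) (Fin m) F) : F := ∑ i, ∑ j, M i j * N i j

lemma pairing_add_left (M M' N : Matrix (Fin n) (Fin m) F) :
    pairing (M + M') N = pairing M N + pairing M' N := by
  simp [pairing, add_mul, Finset.sum_add_distrib]

lemma pairing_sub_right (M N N' : Matrix (Fin n) (Fin m) F) :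
    pairing M (N - N') = pairing M N - pairing M N' := by
  simp [pairing, mul_sub, Finset.sum_sub_distrib]

lemma pairing_zero_left (N : Matrix (Fin n) (Fin m) F) : pairing 0 N = 0 := by
  simp [pairing]

lemma pairing_vecMulVec (x : Fin n → F) (y : Fin m → F) (N : Matrix (Fin n) (Fin m) F) :
    pairing (vecMulVec x y) N = x ⬝ᵥ N *ᵥ y := by
  simp only [pairing, vecMulVec_apply, dotProduct, mulVec, Finset.mul_sum]
  exact Finset.sum_congr rfl fun i _ => Finset.sum_congr rfl fun j _ => by ring

variable [Fintype F]

/-- A fixed primitive additive character of `F`. -/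
abbrev chi (F : Type*) [Field F] [Fintype F] : AddChar F ℂ :=
  AddChar.FiniteField.primitiveChar_to_Complex F

lemma chi_sum {ι : Type*} (s : Finset ι) (f : ι → F) :
    chi F (∑ i ∈ s, f i) = ∏ i ∈ s, chi F (f i) := by
  classical
  induction s using Finset.induction_on with
  | empty => simp
  | insert a s ha ih => rw [Finset.sum_insert ha, Finset.prod_insert ha, AddChar.map_add_eq_mul, ih]

lemma sum_chi_dotProduct {ι : Type*} [Fintype ι] [DecidableEq ι] [DecidableEq F]
    (w : ι → F) :
    ∑ x : ι → F, chi F (x ⬝ᵥ w) = if w = 0 then (Fintype.card F : ℂ) ^ Fintype.card ι else 0 := by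
  classical
  have h : ∀ x : ι → F, chi F (x ⬝ᵥ w) = ∏ i, chi F (x i * w i) := fun x =>
    chi_sum _ _
  simp only [h]
  rw [← Fintype.piFinset_univ, ← Finset.prod_univ_sum (fun _ => Finset.univ)
    (fun i a => chi F (a * w i))]
  simp only [AddChar.sum_mulShift _ (AddChar.FiniteField.primitiveChar_to_Complex_isPrimitive F)]
  split_ifs with hw
  · simp [hw]
  · obtain ⟨i, hi⟩ := Function.ne_iff.1 hw
    exact Finset.prod_eq_zero (Finset.mem_univ i) (by simpa using hi)

lemma sum_chi_pairing (N : Matrix (Fin n) (Fin m) F) (hN : N ≠ 0) :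
    ∑ M : Matrix (Fin n) (Fin m) F, chi F (pairing M N) = 0 := by
  classical
  have h : ∀ M : Matrix (Fin n) (Fin m) F, chi F (pairing M N) = ∏ i, chi F (M i ⬝ᵥ N i) :=
    fun M => chi_sum _ _
  simp only [h]
  have h2 := Finset.prod_univ_sum (fun _ : Fin n => (Finset.univ : Finset (Fin m → F)))
    (fun i a => chi F (a ⬝ᵥ N i))
  rw [Fintype.piFinset_univ] at h2
  refine Eq.trans h2.symm ?_
  obtain ⟨i, hi⟩ : ∃ i, N i ≠ 0 := Function.ne_iff.1 hN
  refine Finset.prod_eq_zero (Finset.mem_univ i) ?_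
  rw [sum_chi_dotProduct, if_neg hi]

open Classical in
/-- The sum of the characters attached to the matrices of rank `v`, evaluated at `N`: an
eigenvalue of the `v`-th relation of the bilinear forms scheme. -/
def rankSum (v : ℕ) (N : Matrix (Fin n) (Fin m) F) : ℂ :=
  ∑ M : Matrix (Fin n) (Fin m) F, if M.rank = v then chi F (pairing M N) else 0

lemma rankSum_zero (N : Matrix (Fin n) (Fin m) F) : rankSum 0 N = 1 := by
  classical
  rw [rankSum, Finset.sum_eq_single 0]
  · simp [pairing_zero_left]
  · intro M _ hM
    rw [if_neg]
    rwa [matrix_rank_eq_zero]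
  · simp

/-- The sum over all pairs of nonzero vectors is `(q - 1) θ_u`, where `u` is the rank. -/
lemma sum_pairs_chi (hnm : n ≤ m) (N : Matrix (Fin n) (Fin m) F) :
    ∑ p ∈ pairs F (Fin n) (Fin m), chi F (pairing (vecMulVec p.1 p.2) N) =
      (((Fintype.card F : ℝ) - 1) * bilinTheta (Fintype.card F) n m N.rank : ℝ) := by
  classical
  have hq : (1 : ℝ) < Fintype.card F := one_lt_card_real
  have hq' : (Fintype.card F : ℝ) - 1 ≠ 0 := by linarith
  have hpairs : pairs F (Fin n) (Fin m) = (Finset.univ.erase 0) ×ˢ (Finset.univ.erase 0) := by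
    ext p
    simp [pairs]
  have hinner : ∀ y : Fin m → F, ∑ x ∈ Finset.univ.erase 0, chi F (x ⬝ᵥ N *ᵥ y) =
      (if N *ᵥ y = 0 then (Fintype.card F : ℂ) ^ n else 0) - 1 := by
    intro y
    rw [Finset.sum_erase_eq_sub (Finset.mem_univ _), sum_chi_dotProduct, Fintype.card_fin]
    simp
  have hker : ((Finset.univ.filter fun y => N *ᵥ y = 0).card) =
      Fintype.card F ^ (m - N.rank) := by
    have h1 := Module.card_eq_pow_finrank (K := F) (V := LinearMap.ker N.mulVecLin)
    have h2 := LinearMap.finrank_range_add_finrank_ker N.mulVecLin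
    rw [Module.finrank_fin_fun] at h2
    change N.rank + _ = m at h2
    rw [show Module.finrank F (LinearMap.ker N.mulVecLin) = m - N.rank by omega] at h1
    rw [← h1, Fintype.card_subtype]
    simp
  rw [hpairs, Finset.sum_product_right]
  simp only [pairing_vecMulVec, hinner]
  rw [Finset.sum_erase_eq_sub (Finset.mem_univ _), Finset.sum_sub_distrib, ← Finset.sum_filter,
    Finset.sum_const, hker]
  have hn : N.rank ≤ n := N.rank_le_height
  rw [bilinTheta, mul_div_cancel₀ _ hq']
  obtain ⟨a, ha⟩ := Nat.exists_eq_add_of_le hn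
  obtain ⟨b, hb⟩ := Nat.exists_eq_add_of_le hnm
  have hmr : m - N.rank = a + b := by omega
  have hnr : n - N.rank = a := by omega
  rw [hmr, hnr]
  have hm : m = N.rank + a + b := by omega
  generalize N.rank = r at *
  subst hb
  subst ha
  simp
  ring

/-- Convolution with the rank-one matrices acts on the eigenvalues by the intersection numbers
of the bilinear forms scheme. -/
lemma sum_pairs_chi_mul_rankSum (v : ℕ) (N : Matrix (Fin n) (Fin m) F) :
    (∑ p ∈ pairs F (Fin n) (Fin m), chi F (pairing (vecMulVec p.1 p.2) N)) * rankSum v N =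
      ((Fintype.card F : ℝ) - 1 : ℝ) * ∑ M : Matrix (Fin n) (Fin m) F,
        (rankStep (Fintype.card F) n m M.rank v : ℂ) * chi F (pairing M N) := by
  classical
  have h1 : ∀ p : (Fin n → F) × (Fin m → F), chi F (pairing (vecMulVec p.1 p.2) N) * rankSum v N =
      ∑ M : Matrix (Fin n) (Fin m) F,
        if (M - vecMulVec p.1 p.2).rank = v then chi F (pairing M N) else 0 := by
    intro p
    rw [rankSum, Finset.mul_sum]
    refine Fintype.sum_equiv (Equiv.addLeft (vecMulVec p.1 p.2)) _ _ fun M => ?_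
    rw [Equiv.coe_addLeft, add_sub_cancel_left, pairing_add_left, AddChar.map_add_eq_mul]
    split_ifs <;> simp
  rw [Finset.sum_mul, Finset.sum_congr rfl fun p _ => h1 p, Finset.sum_comm, Finset.mul_sum]
  refine Finset.sum_congr rfl fun M _ => ?_
  rw [← Finset.sum_filter, Finset.sum_const, nsmul_eq_mul, ← mul_assoc]
  congr 1
  have := card_pairs_rank_sub_eq M v
  exact_mod_cast congrArg (fun r : ℝ => (r : ℂ)) this

lemma bilinTheta_mul_rankSum (hnm : n ≤ m) (v : ℕ) (N : Matrix (Fin n) (Fin m) F) :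
    (bilinTheta (Fintype.card F) n m N.rank : ℂ) * rankSum v N =
      ∑ M : Matrix (Fin n) (Fin m) F,
        (rankStep (Fintype.card F) n m M.rank v : ℂ) * chi F (pairing M N) := by
  have hq : (1 : ℝ) < Fintype.card F := one_lt_card_real
  have hq' : (((Fintype.card F : ℝ) - 1 : ℝ) : ℂ) ≠ 0 := by
    exact_mod_cast (by linarith : (Fintype.card F : ℝ) - 1 ≠ 0)
  have h := sum_pairs_chi_mul_rankSum v N
  rw [sum_pairs_chi hnm, Complex.ofReal_mul, mul_assoc] at h
  exact mul_left_cancel₀ hq' h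

lemma bilinTheta_eq_rankSum_one (hnm : n ≤ m) (N : Matrix (Fin n) (Fin m) F) :
    (bilinTheta (Fintype.card F) n m N.rank : ℂ) = rankSum 1 N := by
  have h := bilinTheta_mul_rankSum hnm 0 N
  rw [rankSum_zero, mul_one] at h
  rw [h, rankSum]
  refine Finset.sum_congr rfl fun M _ => ?_
  by_cases h1 : M.rank = 1
  · simp [rankStep, h1, bilinC_one (one_lt_card_real (F := F))]
  · by_cases h0 : M.rank = 0
    · simp [rankStep, h0, bilinA, bilinC_zero]
    · simp [rankStep, h1, h0]

lemma bilinTheta_mul_rankSum_succ (hnm : n ≤ m) (v : ℕ) (N : Matrix (Fin n) (Fin m) F) :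
    (bilinTheta (Fintype.card F) n m N.rank : ℂ) * rankSum (v + 1) N =
      bilinC (Fintype.card F) (v + 2) * rankSum (v + 2) N +
      bilinA (Fintype.card F) n m (v + 1) * rankSum (v + 1) N +
      bilinB (Fintype.card F) n m v * rankSum v N := by
  rw [bilinTheta_mul_rankSum hnm]
  simp only [rankSum, Finset.mul_sum]
  rw [← Finset.sum_add_distrib, ← Finset.sum_add_distrib]
  refine Finset.sum_congr rfl fun M _ => ?_
  by_cases h1 : M.rank = v + 2
  · simp [rankStep, h1]
  · by_cases h2 : M.rank = v + 1
    · simp [rankStep, h2]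
    · by_cases h3 : M.rank = v
      · simp [rankStep, h3, show ¬ (v = v + 1 + 1) by omega]
      · simp [rankStep, h1, h2, h3]

/-- The polynomials `p_v` at `θ_u` are the eigenvalues of the bilinear forms scheme. -/
lemma bilinP_bilinTheta (hnm : n ≤ m) (v : ℕ) (N : Matrix (Fin n) (Fin m) F) :
    (bilinP (Fintype.card F) n m (bilinTheta (Fintype.card F) n m N.rank) v : ℂ) =
      rankSum v N := by
  induction v using Nat.twoStepInduction with
  | zero => simp [bilinP, rankSum_zero]
  | one => simpa [bilinP] using bilinTheta_eq_rankSum_one hnm N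
  | more v h0 h1 =>
    have hc : (bilinC (Fintype.card F) (v + 2) : ℂ) ≠ 0 := by
      exact_mod_cast (bilinC_pos (one_lt_card_real (F := F)) (by omega)).ne'
    rw [bilinP]
    push_cast
    rw [h0, h1, div_eq_iff hc]
    linear_combination bilinTheta_mul_rankSum_succ hnm v N

end Characters

/-! ### The eigenmatrix of the sum-rank-metric scheme -/

section Scheme

open Matrix

variable {F : Type*} [Field F] {t : ℕ} {n m : Fin t → ℕ}

/-- The tuple of the ranks of the components of `X`, which is the relation of the
sum-rank-metric scheme that contains the pair `(X, 0)`. -/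
def rankProfile (X : Space F n m) : Idx n := fun i =>
  ⟨(X i).rank, Nat.lt_succ_of_le (X i).rank_le_height⟩

lemma rankProfile_eq_zero {X : Space F n m} : rankProfile X = 0 ↔ X = 0 := by
  simp [funext_iff, rankProfile, Fin.ext_iff, matrix_rank_eq_zero]

lemma rankProfile_eq_iff {X : Space F n m} {k : Idx n} :
    rankProfile X = k ↔ ∀ i, (X i).rank = k i := by
  simp [funext_iff, rankProfile, Fin.ext_iff]

lemma minDist_le_srk {C : Set (Space F n m)} {X Y : Space F n m} (hX : X ∈ C) (hY : Y ∈ C)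
    (h : X ≠ Y) : minDist C ≤ srk (X - Y) :=
  iInf₂_le_of_le X hX (iInf₂_le_of_le Y hY (iInf_le _ h))

variable [Fintype F]

lemma exists_rankProfile_eq (hnm : ∀ i, n i ≤ m i) (k : Idx n) :
    ∃ X : Space F n m, rankProfile X = k := by
  have h : ∀ i, ∃ M : Matrix (Fin (n i)) (Fin (m i)) F, M.rank = k i := fun i =>
    exists_rank_eq (Nat.le_of_lt_succ (k i).2) ((Nat.le_of_lt_succ (k i).2).trans (hnm i))
  choose X hX using h
  exact ⟨X, rankProfile_eq_iff.2 hX⟩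

/-- The character of the additive group of the space attached to the word `X`, evaluated at
`Y`. -/
def spaceChar (X Y : Space F n m) : ℂ := ∏ i, chi F (pairing (X i) (Y i))

lemma spaceChar_zero_right (X : Space F n m) : spaceChar X 0 = 1 := by
  simp [spaceChar, pairing]

lemma spaceChar_sub (X Y Z : Space F n m) :
    spaceChar X (Y - Z) = spaceChar X Y * starRingEnd ℂ (spaceChar X Z) := by
  rw [spaceChar, spaceChar, spaceChar, map_prod, ← Finset.prod_mul_distrib]
  refine Finset.prod_congr rfl fun i _ => ?_
  rw [Pi.sub_apply, pairing_sub_right, sub_eq_add_neg, AddChar.map_add_eq_mul,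
    AddChar.map_neg_eq_conj]

lemma sum_spaceChar (Y : Space F n m) (hY : Y ≠ 0) : ∑ X, spaceChar X Y = 0 := by
  have h := Finset.prod_univ_sum
    (fun i : Fin t => (Finset.univ : Finset (Matrix (Fin (n i)) (Fin (m i)) F)))
    (fun i M => chi F (pairing M (Y i)))
  rw [Fintype.piFinset_univ] at h
  refine h.symm.trans ?_
  obtain ⟨i, hi⟩ : ∃ i, Y i ≠ 0 := Function.ne_iff.1 hY
  exact Finset.prod_eq_zero (Finset.mem_univ i) (sum_chi_pairing _ hi)

open Classical in
/-- The entries of the eigenmatrix `Q` are character sums over the words with a given rank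
profile. -/
lemma sumRankQ_rankProfile (hnm : ∀ i, n i ≤ m i) (Y : Space F n m) (k : Idx n) :
    (sumRankQ (Fintype.card F) n m (rankProfile Y) k : ℂ) =
      ∑ X : Space F n m, if rankProfile X = k then spaceChar X Y else 0 := by
  have h1 : (sumRankQ (Fintype.card F) n m (rankProfile Y) k : ℂ) =
      ∏ i, rankSum (k i) (Y i) := by
    simp only [sumRankQ, of_apply, Complex.ofReal_prod]
    exact Finset.prod_congr rfl fun i _ => bilinP_bilinTheta (hnm i) (k i) (Y i)
  have h2 := Finset.prod_univ_sum
    (fun i : Fin t => (Finset.univ : Finset (Matrix (Fin (n i)) (Fin (m i)) F)))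
    (fun i M => if M.rank = k i then chi F (pairing M (Y i)) else 0)
  rw [Fintype.piFinset_univ] at h2
  rw [h1]
  refine h2.trans (Finset.sum_congr rfl fun X _ => ?_)
  rw [Finset.prod_ite_zero]
  simp only [Finset.mem_univ, forall_const, rankProfile_eq_iff]
  rfl

lemma sumRankQ_zero_right (q : ℕ) (j : Idx n) : sumRankQ q n m j 0 = 1 := by
  simp [sumRankQ, bilinQ, bilinP]

lemma sum_sumRankQ (F : Type*) [Field F] [Fintype F] (hnm : ∀ i, n i ≤ m i) (j : Idx n) :
    ∑ k, sumRankQ (Fintype.card F) n m j k =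
      if j = 0 then (Fintype.card (Space F n m) : ℝ) else 0 := by
  classical
  obtain ⟨Y, rfl⟩ := exists_rankProfile_eq (F := F) hnm j
  have h : ((∑ k, sumRankQ (Fintype.card F) n m (rankProfile Y) k : ℝ) : ℂ) =
      ∑ X : Space F n m, spaceChar X Y := by
    rw [Complex.ofReal_sum, Finset.sum_congr rfl fun k _ => sumRankQ_rankProfile hnm Y k,
      Finset.sum_comm]
    simp
  split_ifs with hY
  · rw [rankProfile_eq_zero] at hY
    subst hY
    simp only [spaceChar_zero_right, Finset.sum_const, Finset.card_univ, nsmul_eq_mul,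
      mul_one] at h
    exact_mod_cast h
  · rw [sum_spaceChar Y (fun h0 => hY (rankProfile_eq_zero.2 h0))] at h
    exact_mod_cast h

end Scheme

/-! ### Real positive semidefinite matrices -/

section PosSemidef

open Matrix

variable {ι : Type*} [Fintype ι]

lemma isClosed_setOf_posSemidef : IsClosed {X : Matrix ι ι ℝ | X.PosSemidef} := by
  simp only [posSemidef_iff_dotProduct_mulVec, Set.ofPred_and, Set.ofPred_forall]
  refine IsClosed.inter (isClosed_eq (by fun_prop) continuous_id) (isClosed_iInter fun x => ?_)
  exact isClosed_le continuous_const (by fun_prop)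

lemma sum_nonneg_of_posSemidef {X : Matrix ι ι ℝ} (hX : X.PosSemidef) (w : ι → ℝ) :
    0 ≤ ∑ u, ∑ v, X u v * (w u * w v) := by
  have h := (posSemidef_iff_dotProduct_mulVec.1 hX).2 w
  simp only [dotProduct, mulVec, Finset.mul_sum] at h
  refine h.trans_eq (Finset.sum_congr rfl fun u _ => Finset.sum_congr rfl fun v _ => ?_)
  simp only [Pi.star_apply, star_trivial]
  ring

lemma two_mul_le_of_posSemidef {X : Matrix ι ι ℝ} (hX : X.PosSemidef) (u v : ι) :
    2 * X u v ≤ X u u + X v v := by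
  classical
  have h := (posSemidef_iff_dotProduct_mulVec.1 hX).2 (Pi.single u 1 - Pi.single v 1)
  have hs : X v u = X u v := by simpa using hX.1.apply u v
  simp only [star_trivial, sub_dotProduct, mulVec_sub, dotProduct_sub, mulVec_single_one,
    single_one_dotProduct, col_apply, hs] at h
  linarith

/-- The Cauchy–Schwarz inequality between a coordinate vector and the all-ones vector. -/
lemma sq_sum_row_le_of_posSemidef {X : Matrix ι ι ℝ} (hX : X.PosSemidef) (o : ι) (ho : X o o = 1) :
    (∑ u, X o u) ^ 2 ≤ ∑ u, ∑ v, X u v := by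
  classical
  set s := ∑ u, X o u
  -- at this vector the form equals `∑ u, ∑ v, X u v - s ^ 2`
  have h := (posSemidef_iff_dotProduct_mulVec.1 hX).2 (1 - s • Pi.single o 1)
  have h1 : (X *ᵥ 1) o = s := by simp [mulVec, dotProduct, s]
  have h2 : (1 : ι → ℝ) ⬝ᵥ X.col o = s := by
    simp only [dotProduct, col_apply, Pi.one_apply, one_mul, s]
    exact Finset.sum_congr rfl fun u _ => by simpa using hX.1.apply o u
  have h3 : (1 : ι → ℝ) ⬝ᵥ X *ᵥ 1 = ∑ u, ∑ v, X u v := by simp [mulVec, dotProduct]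
  simp only [star_trivial, sub_dotProduct, mulVec_sub, dotProduct_sub, mulVec_smul, smul_dotProduct,
    dotProduct_smul, mulVec_single_one, single_one_dotProduct, col_apply, smul_eq_mul, h1, h2, h3,
    ho] at h
  linarith

omit [Fintype ι] in
lemma isCompact_setOf_entries_mem_Icc (c : ℝ) :
    IsCompact {X : Matrix ι ι ℝ | ∀ u v, X u v ∈ Set.Icc 0 c} := by
  have h : IsCompact (Set.univ.pi fun _ : ι => Set.univ.pi fun _ : ι => Set.Icc (0 : ℝ) c) :=
    isCompact_univ_pi fun _ => isCompact_univ_pi fun _ => isCompact_Icc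
  have heq : {X : Matrix ι ι ℝ | ∀ u v, X u v ∈ Set.Icc 0 c} =
      (Set.univ.pi fun _ : ι => Set.univ.pi fun _ : ι => Set.Icc (0 : ℝ) c) :=
    Set.ext fun X => ⟨fun h u _ v _ => h u v, fun h u v => h u trivial v trivial⟩
  rw [heq]
  exact h

lemma posSemidef_single [DecidableEq ι] (o : ι) : (Matrix.single o o (1 : ℝ)).PosSemidef := by
  rw [posSemidef_iff_dotProduct_mulVec]
  refine ⟨?_, fun x => ?_⟩
  · simp [IsHermitian]
  · rw [single_mulVec]
    simpa [Function.update_eq_iff, dotProduct, Function.update_apply] using mul_self_nonneg (x o)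

end PosSemidef

/-! ### The three programs -/

section Programs

open Matrix

variable {F : Type*} [Field F] [Fintype F] {t : ℕ} {n m : Fin t → ℕ} {d : ℕ}

lemma IsSchrijverFeasible.entry_mem_Icc {X : Matrix (Space F n m) (Space F n m) ℝ}
    (hX : IsSchrijverFeasible d X) (u v : Space F n m) : X u v ∈ Set.Icc 0 1 := by
  -- the bound `2 X 0 w ≤ X 0 0 + X w w` reads `2 X w w ≤ 1 + X w w`
  have hdiag : ∀ w, X w w ≤ 1 := fun w => by
    have := two_mul_le_of_posSemidef hX.posSemidef 0 w
    rw [hX.zero_left, hX.zero_zero] at this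
    linarith
  exact ⟨hX.nonneg u v, by
    linarith [two_mul_le_of_posSemidef hX.posSemidef u v, hdiag u, hdiag v]⟩

lemma isCompact_setOf_isSchrijverFeasible :
    IsCompact {X : Matrix (Space F n m) (Space F n m) ℝ | IsSchrijverFeasible d X} := by
  refine (isCompact_setOf_entries_mem_Icc 1).of_isClosed_subset ?_ fun X hX => hX.entry_mem_Icc
  have h : {X : Matrix (Space F n m) (Space F n m) ℝ | IsSchrijverFeasible d X} =
      {X | X 0 0 = 1} ∩ {X | ∀ u, X 0 u = X u u} ∩
        {X | ∀ u v, minDist ({0, u, v} : Set (Space F n m)) < (d : ℕ∞) → X u v = 0} ∩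
        {X | ∀ u v, X u v = X v u} ∩ {X | ∀ u v, 0 ≤ X u v} ∩ {X | X.PosSemidef} := by
    ext X
    exact ⟨fun h => ⟨⟨⟨⟨⟨h.1, h.2⟩, h.3⟩, h.4⟩, h.5⟩, h.6⟩,
      fun ⟨⟨⟨⟨⟨h1, h2⟩, h3⟩, h4⟩, h5⟩, h6⟩ => ⟨h1, h2, h3, h4, h5, h6⟩⟩
  rw [h]
  have hc : ∀ u v, Continuous fun X : Matrix (Space F n m) (Space F n m) ℝ => X u v :=
    fun u v => by fun_prop
  simp only [Set.ofPred_forall]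
  exact (((((isClosed_eq (hc _ _) continuous_const).inter
    (isClosed_iInter fun u => isClosed_eq (hc _ _) (hc _ _))).inter
    (isClosed_iInter fun u => isClosed_iInter fun v => isClosed_iInter fun _ =>
      isClosed_eq (hc _ _) continuous_const)).inter
    (isClosed_iInter fun u => isClosed_iInter fun v => isClosed_eq (hc _ _) (hc _ _))).inter
    (isClosed_iInter fun u => isClosed_iInter fun v =>
      isClosed_le continuous_const (hc _ _))).inter isClosed_setOf_posSemidef

/-- The point that corresponds to the code `{0}` is feasible. -/
lemma isSchrijverFeasible_single [DecidableEq (Space F n m)] :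
    IsSchrijverFeasible d (Matrix.single (0 : Space F n m) 0 (1 : ℝ)) where
  zero_zero := by simp
  zero_left u := by
    simp only [single_apply]
    split_ifs <;> simp_all
  dist u v h := by
    rw [single_apply, if_neg]
    rintro ⟨rfl, rfl⟩
    have : minDist ({0, 0, 0} : Set (Space F n m)) = ⊤ := by simp [minDist]
    rw [this] at h
    exact not_top_lt h
  symm u v := by simp only [single_apply, and_comm]
  nonneg u v := by
    rw [single_apply]
    split_ifs <;> norm_num
  posSemidef := posSemidef_single 0

lemma isGreatest_schrijverSDP :
    IsGreatest (schrijverValues F n m d) (schrijverSDP F n m d) := by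
  classical
  refine IsCompact.isGreatest_sSup ?_
    ⟨_, Matrix.single (0 : Space F n m) 0 (1 : ℝ), isSchrijverFeasible_single, rfl⟩
  have h : schrijverValues F n m d = (fun X : Matrix (Space F n m) (Space F n m) ℝ => X.trace) ''
      {X | IsSchrijverFeasible d X} := by
    ext r
    simp [schrijverValues, eq_comm]
  rw [h]
  exact isCompact_setOf_isSchrijverFeasible.image (by fun_prop)

lemma isCompact_setOf_isDelsarteSDPFeasible :
    IsCompact {B : Matrix (Space F n m) (Space F n m) ℝ | IsDelsarteSDPFeasible d B} := by
  refine (isCompact_setOf_entries_mem_Icc 1).of_isClosed_subset ?_ fun B hB u v => ?_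
  · have h : {B : Matrix (Space F n m) (Space F n m) ℝ | IsDelsarteSDPFeasible d B} =
        {B | ∀ u v, 0 ≤ B u v} ∩ {B | ∀ u v, B u v = B v u} ∩
          {B | ∀ u v, u ≠ v → srk (u - v) < d → B u v = 0} ∩ {B | B.trace = 1} ∩
          {B | B.PosSemidef} := by
      ext B
      exact ⟨fun h => ⟨⟨⟨⟨h.1, h.2⟩, h.3⟩, h.4⟩, h.5⟩,
        fun ⟨⟨⟨⟨h1, h2⟩, h3⟩, h4⟩, h5⟩ => ⟨h1, h2, h3, h4, h5⟩⟩
    rw [h]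
    have hc : ∀ u v, Continuous fun X : Matrix (Space F n m) (Space F n m) ℝ => X u v :=
      fun u v => by fun_prop
    simp only [Set.ofPred_forall]
    exact ((((isClosed_iInter fun u => isClosed_iInter fun v =>
        isClosed_le continuous_const (hc _ _)).inter
      (isClosed_iInter fun u => isClosed_iInter fun v => isClosed_eq (hc _ _) (hc _ _))).inter
      (isClosed_iInter fun u => isClosed_iInter fun v => isClosed_iInter fun _ =>
        isClosed_iInter fun _ => isClosed_eq (hc _ _) continuous_const)).inter
      (isClosed_eq (by fun_prop) continuous_const)).inter isClosed_setOf_posSemidef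
  · have hdiag : ∀ w, B w w ≤ 1 := fun w => by
      rw [← hB.trace]
      exact Finset.single_le_sum (f := fun w => B w w) (fun w _ => hB.nonneg w w)
        (Finset.mem_univ w)
    exact ⟨hB.nonneg u v, by
      linarith [two_mul_le_of_posSemidef hB.posSemidef u v, hdiag u, hdiag v]⟩

/-- Scaling a feasible point of the three-point program to trace `1` gives a feasible point of the
semidefinite form of Delsarte's program, with at least the same objective value. -/
lemma IsSchrijverFeasible.exists_isDelsarteSDPFeasible
    {X : Matrix (Space F n m) (Space F n m) ℝ} (hX : IsSchrijverFeasible d X) :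
    ∃ B : Matrix (Space F n m) (Space F n m) ℝ,
      IsDelsarteSDPFeasible d B ∧ X.trace ≤ ∑ u, ∑ v, B u v := by
  have htr : 0 < X.trace := by
    have : X 0 0 ≤ X.trace := Finset.single_le_sum (f := fun w => X w w)
      (fun w _ => hX.nonneg w w) (Finset.mem_univ 0)
    rw [hX.zero_zero] at this
    linarith
  refine ⟨X.trace⁻¹ • X, ⟨fun u v => ?_, fun u v => ?_, fun u v huv h => ?_, ?_, ?_⟩, ?_⟩
  · exact mul_nonneg (inv_nonneg.2 htr.le) (hX.nonneg u v)
  · rw [Matrix.smul_apply, Matrix.smul_apply, hX.symm]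
  · have hd : minDist ({0, u, v} : Set (Space F n m)) < (d : ℕ∞) :=
      (minDist_le_srk (by simp) (by simp) huv).trans_lt (by exact_mod_cast h)
    rw [Matrix.smul_apply, hX.dist u v hd, smul_zero]
  · rw [trace_smul, smul_eq_mul, inv_mul_cancel₀ htr.ne']
  · exact hX.posSemidef.smul (inv_nonneg.2 htr.le)
  · have h := sq_sum_row_le_of_posSemidef hX.posSemidef 0 hX.zero_zero
    have hrow : ∑ u, X 0 u = X.trace := Finset.sum_congr rfl fun u _ => hX.zero_left u
    rw [hrow] at h
    have hsum : ∑ u, ∑ v, (X.trace⁻¹ • X) u v = X.trace⁻¹ * ∑ u, ∑ v, X u v := by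
      simp only [Matrix.smul_apply, smul_eq_mul, Finset.mul_sum]
    rw [hsum]
    rw [← div_eq_inv_mul, le_div_iff₀ htr, ← sq]
    exact h

lemma isGreatest_delsarteSDP :
    IsGreatest (delsarteSDPValues F n m d) (delsarteSDP F n m d) := by
  classical
  obtain ⟨B, hB, -⟩ := (isSchrijverFeasible_single (F := F) (n := n) (m := m)
    (d := d)).exists_isDelsarteSDPFeasible
  refine IsCompact.isGreatest_sSup ?_ ⟨_, B, hB, rfl⟩
  have h : delsarteSDPValues F n m d =
      (fun B : Matrix (Space F n m) (Space F n m) ℝ => ∑ u, ∑ v, B u v) ''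
        {B | IsDelsarteSDPFeasible d B} := by
    ext r
    simp [delsarteSDPValues, eq_comm]
  rw [h]
  exact isCompact_setOf_isDelsarteSDPFeasible.image (by fun_prop)

/-- The character sums of a positive semidefinite matrix are nonnegative. -/
lemma sum_mul_re_spaceChar_nonneg {B : Matrix (Space F n m) (Space F n m) ℝ}
    (hB : B.PosSemidef) (X : Space F n m) :
    0 ≤ ∑ u, ∑ v, B u v * (spaceChar X (u - v)).re := by
  have h1 := sum_nonneg_of_posSemidef hB fun u => (spaceChar X u).re
  have h2 := sum_nonneg_of_posSemidef hB fun u => (spaceChar X u).im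
  refine (add_nonneg h1 h2).trans_eq ?_
  simp only [← Finset.sum_add_distrib]
  refine Finset.sum_congr rfl fun u _ => Finset.sum_congr rfl fun v _ => ?_
  rw [spaceChar_sub, Complex.mul_re, Complex.conj_re, Complex.conj_im]
  ring

/-- Collecting the entries of a feasible point of the semidefinite program along the relations of
the scheme gives a feasible point of the linear program with the same objective value. -/
lemma IsDelsarteSDPFeasible.exists_isDelsarteLPFeasible (hnm : ∀ i, n i ≤ m i)
    {B : Matrix (Space F n m) (Space F n m) ℝ} (hB : IsDelsarteSDPFeasible d B) :
    ∃ a : Idx n → ℝ, IsDelsarteLPFeasible (Fintype.card F) n m d a ∧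
      ∑ j, a j = ∑ u, ∑ v, B u v := by
  classical
  have hcollect : ∀ g : Idx n → ℝ,
      ∑ j, (∑ u, ∑ v, if rankProfile (u - v) = j then B u v else 0) * g j =
        ∑ u, ∑ v, B u v * g (rankProfile (u - v)) := by
    intro g
    simp only [Finset.sum_mul]
    rw [Finset.sum_comm]
    refine Finset.sum_congr rfl fun u _ => ?_
    rw [Finset.sum_comm]
    refine Finset.sum_congr rfl fun v _ => ?_
    simp
  refine ⟨fun j => ∑ u, ∑ v, if rankProfile (u - v) = j then B u v else 0,
    ⟨fun k => ?_, fun j => ?_, ?_, fun j hj0 hjd => ?_⟩, ?_⟩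
  · have h1 : ∀ Y : Space F n m, sumRankQ (Fintype.card F) n m (rankProfile Y) k =
        ∑ X : Space F n m, if rankProfile X = k then (spaceChar X Y).re else 0 := by
      intro Y
      have := congrArg Complex.re (sumRankQ_rankProfile hnm Y k)
      rw [Complex.ofReal_re, Complex.re_sum] at this
      rw [this]
      exact Finset.sum_congr rfl fun X _ => by split_ifs <;> simp
    simp only [vecMul, dotProduct]
    rw [hcollect fun j => sumRankQ (Fintype.card F) n m j k]
    simp only [h1, Finset.mul_sum]
    rw [Finset.sum_congr rfl fun u _ => Finset.sum_comm, Finset.sum_comm]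
    refine Finset.sum_nonneg fun X _ => ?_
    split_ifs
    · exact sum_mul_re_spaceChar_nonneg hB.posSemidef X
    · simp
  · exact Finset.sum_nonneg fun u _ => Finset.sum_nonneg fun v _ => by
      split_ifs
      exacts [hB.nonneg u v, le_rfl]
  · rw [← hB.trace]
    simp [rankProfile_eq_zero, sub_eq_zero, Matrix.trace]
  · refine Finset.sum_eq_zero fun u _ => Finset.sum_eq_zero fun v _ => ?_
    split_ifs with h
    · subst h
      refine hB.dist u v ?_ hjd
      rintro rfl
      simp [rankProfile] at hj0
    · rfl
  · simpa using hcollect fun _ => 1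

/-- Summing all constraints `(a Q)_k ≥ 0` bounds the constraint value at `k = 0`, which is the
objective, because the rows of `Q` other than the first sum to zero. -/
lemma IsDelsarteLPFeasible.sum_le (F : Type*) [Field F] [Fintype F] (hnm : ∀ i, n i ≤ m i)
    {a : Idx n → ℝ} (ha : IsDelsarteLPFeasible (Fintype.card F) n m d a) :
    ∑ j, a j ≤ Fintype.card (Space F n m) := by
  have h0 : vecMul a (sumRankQ (Fintype.card F) n m) 0 = ∑ j, a j := by
    simp [vecMul, dotProduct, sumRankQ_zero_right]
  have h1 : ∑ k, vecMul a (sumRankQ (Fintype.card F) n m) k = Fintype.card (Space F n m) := by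
    simp only [vecMul, dotProduct]
    rw [Finset.sum_comm]
    simp only [← Finset.mul_sum, sum_sumRankQ F hnm]
    simp [ha.zero]
  rw [← h0, ← h1]
  exact Finset.single_le_sum (f := fun k => vecMul a (sumRankQ (Fintype.card F) n m) k)
    (fun k _ => ha.mul_Q_nonneg k) (Finset.mem_univ 0)

lemma isCompact_setOf_isDelsarteLPFeasible (F : Type*) [Field F] [Fintype F]
    (hnm : ∀ i, n i ≤ m i) :
    IsCompact {a : Idx n → ℝ | IsDelsarteLPFeasible (Fintype.card F) n m d a} := by
  have hbox : IsCompact (Set.univ.pi fun _ : Idx n =>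
      Set.Icc (0 : ℝ) (Fintype.card (Space F n m))) :=
    isCompact_univ_pi fun _ => isCompact_Icc
  refine hbox.of_isClosed_subset ?_ fun a ha j _ => ⟨ha.nonneg j, ?_⟩
  · have h : {a : Idx n → ℝ | IsDelsarteLPFeasible (Fintype.card F) n m d a} =
        {a | ∀ k, 0 ≤ vecMul a (sumRankQ (Fintype.card F) n m) k} ∩ {a | ∀ j, 0 ≤ a j} ∩
          {a | a 0 = 1} ∩
          {a | ∀ j : Idx n, 0 < ∑ i, (j i : ℕ) → ∑ i, (j i : ℕ) < d → a j = 0} := by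
      ext a
      exact ⟨fun h => ⟨⟨⟨h.1, h.2⟩, h.3⟩, h.4⟩, fun ⟨⟨⟨h1, h2⟩, h3⟩, h4⟩ => ⟨h1, h2, h3, h4⟩⟩
    rw [h]
    simp only [Set.ofPred_forall]
    exact (((isClosed_iInter fun k => isClosed_le continuous_const (by fun_prop)).inter
      (isClosed_iInter fun j => isClosed_le continuous_const (continuous_apply j))).inter
      (isClosed_eq (continuous_apply 0) continuous_const)).inter
      (isClosed_iInter fun j => isClosed_iInter fun _ => isClosed_iInter fun _ =>
        isClosed_eq (continuous_apply j) continuous_const)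
  · exact (Finset.single_le_sum (f := a) (fun j _ => ha.nonneg j) (Finset.mem_univ j)).trans
      (ha.sum_le F hnm)

lemma isGreatest_delsarteLP (F : Type*) [Field F] [Fintype F] (hnm : ∀ i, n i ≤ m i) :
    IsGreatest (delsarteLPValues (Fintype.card F) n m d)
      (delsarteLP (Fintype.card F) n m d) := by
  obtain ⟨B, hB, -⟩ := (isGreatest_delsarteSDP (F := F) (n := n) (m := m) (d := d)).1
  obtain ⟨a, ha, -⟩ := hB.exists_isDelsarteLPFeasible hnm
  refine IsCompact.isGreatest_sSup ?_ ⟨_, a, ha, rfl⟩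
  have h : delsarteLPValues (Fintype.card F) n m d =
      (fun a => ∑ j, a j) '' {a | IsDelsarteLPFeasible (Fintype.card F) n m d a} := by
    ext r
    simp [delsarteLPValues, eq_comm]
  rw [h]
  exact (isCompact_setOf_isDelsarteLPFeasible F hnm).image (by fun_prop)

lemma schrijverSDP_le_delsarteSDP : schrijverSDP F n m d ≤ delsarteSDP F n m d := by
  obtain ⟨X, hX, h⟩ := (isGreatest_schrijverSDP (F := F) (n := n) (m := m) (d := d)).1
  obtain ⟨B, hB, hle⟩ := hX.exists_isDelsarteSDPFeasible
  rw [h]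
  exact hle.trans (isGreatest_delsarteSDP.2 ⟨B, hB, rfl⟩)

lemma delsarteSDP_le_delsarteLP (hnm : ∀ i, n i ≤ m i) :
    delsarteSDP F n m d ≤ delsarteLP (Fintype.card F) n m d := by
  obtain ⟨B, hB, h⟩ := (isGreatest_delsarteSDP (F := F) (n := n) (m := m) (d := d)).1
  obtain ⟨a, ha, hsum⟩ := hB.exists_isDelsarteLPFeasible hnm
  rw [h, ← hsum]
  exact (isGreatest_delsarteLP F hnm).2 ⟨a, ha, rfl⟩

end Programs

end SumRank

end

theorem mainTheorem5 {F : Type*} [Field F] [Fintype F] {t : ℕ} (ht : 0 < t)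
    (n m : Fin t → ℕ) (hn : ∀ i, 0 < n i) (hnm : ∀ i, n i ≤ m i) (hm : Antitone m) (d : ℕ) :
    -- the three optima are attained maxima
    IsGreatest (SumRank.schrijverValues F n m d) (SumRank.schrijverSDP F n m d) ∧
    IsGreatest (SumRank.delsarteLPValues (Fintype.card F) n m d)
      (SumRank.delsarteLP (Fintype.card F) n m d) ∧
    IsGreatest (SumRank.delsarteSDPValues F n m d) (SumRank.delsarteSDP F n m d) ∧
    -- the comparison with Delsarte's bound, in its linear and in its semidefinite form
    SumRank.schrijverSDP F n m d ≤ SumRank.delsarteLP (Fintype.card F) n m d ∧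
    SumRank.schrijverSDP F n m d ≤ SumRank.delsarteSDP F n m d :=
  ⟨SumRank.isGreatest_schrijverSDP, SumRank.isGreatest_delsarteLP F hnm,
    SumRank.isGreatest_delsarteSDP,
    SumRank.schrijverSDP_le_delsarteSDP.trans (SumRank.delsarteSDP_le_delsarteLP hnm),
    SumRank.schrijverSDP_le_delsarteSDP⟩
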